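/- For a real number $\beta>1$ let $F_\beta:[-1,1]\to[-1,1]$, $F_\beta(x)=\cos(\beta\arccos x)$, be the generalized Chebyshev map. By a Galois conjugate of an algebraic number $\beta$ we mean a complex root, different from $\beta$ itself, of the minimal polynomial of $\beta$ over $\mathbb{Q}$ (a transcendental number has no Galois conjugates). Let $\mathbb{D}$ be the open unit disk in $\mathbb{C}$, let $$\mathcal{G}_{[-1,1]}=\Bigl\{z\in\mathbb{D}\ :\ 1+\sum_{n=1}^\infty a_nz^n=0\ \text{ for some real numbers } a_1,a_2,\ldots\in[-1,1]\Bigr\},$$ and let $\mathcal{G}_{[-1,1]}^{-1}=\{z^{-1} : z\in\mathcal{G}_{[-1,1]}\}$ (note that $0\notin\mathcal{G}_{[-1,1]}$). Then the closure in $\mathbb{C}$ of the set of all Galois conjugates of those real numbers $\beta>1$ for which the forward orbit $\{F_\beta^n(-1) : n\ge 0\}$ is a finite set is equal to $$\operatorname{clos}(\mathbb{D})\cup\mathcal{G}_{[-1,1]}^{-1}.$$ -/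

import Mathlib

open scoped Pointwise

/-- The generalized Chebyshev map `F_β(x) = cos(β arccos x)`. It maps `[-1,1]` into itself; only
its values on `[-1,1]` matter, as the orbits considered start in `[-1,1]`. -/
noncomputable def genChebyshev (β x : ℝ) : ℝ := Real.cos (β * Real.arccos x)

/-- The forward orbit `{f^n(x) ; n ≥ 0}`. -/
def forwardOrbit {X : Type*} (f : X → X) (x : X) : Set X := Set.range fun n : ℕ => f^[n] x

/-- The Galois conjugates of a real number `β`: the complex roots of its minimal polynomial
over `ℚ` other than `β` itself (there are none when `β` is transcendental, because
`rootSet` of the zero polynomial is empty). -/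
noncomputable def galoisConjugates (β : ℝ) : Set ℂ := (minpoly ℚ β).rootSet ℂ \ {(β : ℂ)}

/-- Coefficient sequences of the power series `1 + ∑_{n ≥ 1} a_n z^n` with `a_n ∈ I`
for all `n ≥ 1`. -/
def coeffFamily (I : Set ℝ) : Set (ℕ → ℝ) := {a | a 0 = 1 ∧ ∀ n, 1 ≤ n → a n ∈ I}

/-- The set `𝒢_I` of zeros in the open unit disk of the power series
`1 + ∑_{n ≥ 1} a_n z^n` with `a_n ∈ I` for all `n ≥ 1`. -/
def zeroSet (I : Set ℝ) : Set ℂ :=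
  {z | z ∈ Metric.ball (0 : ℂ) 1 ∧
    ∃ a ∈ coeffFamily I, HasSum (fun n : ℕ => (a n : ℂ) * z ^ n) 0}

/-!
As long as `|u| ≤ 1`, the map `F_β` sends `cos (π u)` to `cos (π (β u + 2 k))` for every integer
`k`, so the orbit of `-1` lifts to `u n = P n (β)` for integer polynomials with `P 0 = 1` and
`P (n + 1) = X * P n + 2 k n`, the `k n` being chosen to keep `u n` in `[-1, 1]`. If the orbit is
finite then so is the set of all `P n (β)`, hence so is the set of all `P n (z)` for a conjugate
`z`. By synthetic division,
`P (n + 1) (β) - P (n + 1) (z) = (β - z) * ∑ i ≤ n, P i (β) * z ^ (n - i)`, and dividing by `z ^ n`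
shows that, when `|z| > 1`, the point `z⁻¹` is a zero of the power series with coefficients
`P n (β) ∈ [-1, 1]`.

Conversely, let `A` be monic with its other coefficients in `(-1, 1)`. For large `B`, rounding the
coefficients of `(X - B) * A` to integers congruent to `2` modulo `4` gives a polynomial that is
irreducible by Eisenstein's criterion and has a real root `β` near `B`. The values `P n (β)` are the
coefficients of its quotient by `X - β` and are close to those of `A`, so the lifted orbit stays in
`[-1, 1]` until it ends at `0`, a fixed point, and the conjugates of `β` come close to each root of
`A`. The roots of such `A` include every point `z` of the open unit disk, because `z ^ k → 0` is
a small real combination of `z` and `1`, and they come close to every point of `𝒢⁻¹` by Hurwitz's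
theorem applied to damped truncations of the power series.
-/

open Filter Topology Polynomial Metric

/-- Horner's scheme with the leading coefficient first: `horner c x n = ∑_{j ≤ n} c_j x^(n-j)`. The
lifts to `ℝ` of the orbits of `-1` under `genChebyshev β` are of the form `n ↦ horner c β n`. -/
def horner {R : Type*} [Semiring R] (c : ℕ → R) (x : R) : ℕ → R
  | 0 => c 0
  | n + 1 => x * horner c x n + c (n + 1)

/-- The polynomial with coefficients `c 0, …, c n`, leading coefficient first. -/
noncomputable def hornerPoly {R : Type*} [Semiring R] (c : ℕ → R) (n : ℕ) : R[X] :=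
  horner (fun i => C (c i)) X n

section Horner

theorem map_horner {R S : Type*} [Semiring R] [Semiring S] (f : R →+* S) (c : ℕ → R) (x : R)
    (n : ℕ) : f (horner c x n) = horner (fun i => f (c i)) (f x) n := by
  induction n with
  | zero => rfl
  | succ n ih => simp only [horner, map_add, map_mul, ih]

theorem ofReal_horner (c : ℕ → ℤ) (x : ℝ) (n : ℕ) :
    ((horner (fun i => (c i : ℝ)) x n : ℝ) : ℂ) = horner (fun i => (c i : ℂ)) (x : ℂ) n := by
  simpa using map_horner Complex.ofRealHom (fun i => (c i : ℝ)) x n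

theorem horner_eq_pow {R : Type*} [Semiring R] {c : ℕ → R} (h0 : c 0 = 1) {N : ℕ}
    (hc : ∀ n < N, c (n + 1) = 0) (x : R) : horner c x N = x ^ N := by
  induction N with
  | zero => simp [horner, h0]
  | succ N ih =>
    rw [horner, ih fun n hn => hc n (hn.trans N.lt_succ_self), hc N N.lt_succ_self, add_zero,
      pow_succ']

theorem aeval_hornerPoly {R A : Type*} [CommSemiring R] [Semiring A] [Algebra R A] (c : ℕ → R)
    (x : A) (n : ℕ) : aeval x (hornerPoly c n) = horner (fun i => algebraMap R A (c i)) x n := by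
  simpa [hornerPoly] using map_horner (aeval (R := R) x).toRingHom (fun i => C (c i)) X n

theorem coeff_hornerPoly {R : Type*} [Semiring R] (c : ℕ → R) (n i : ℕ) :
    (hornerPoly c n).coeff i = if i ≤ n then c (n - i) else 0 := by
  induction n generalizing i with
  | zero => cases i <;> simp [hornerPoly, horner, coeff_C]
  | succ n ih =>
    rw [hornerPoly, horner, ← hornerPoly]
    cases i <;> simp [ih, coeff_C]

theorem isMonicOfDegree_hornerPoly {R : Type*} [Semiring R] [Nontrivial R] {c : ℕ → R}
    (h0 : c 0 = 1) (n : ℕ) : (hornerPoly c n).IsMonicOfDegree n := by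
  refine (isMonicOfDegree_iff _ n).2 ⟨natDegree_le_iff_coeff_eq_zero.2 fun i hi => ?_, ?_⟩
  · rw [coeff_hornerPoly, if_neg hi.not_ge]
  · rw [coeff_hornerPoly, if_pos le_rfl, Nat.sub_self, h0]

theorem isEisensteinAt_hornerPoly {R : Type*} [CommRing R] [Nontrivial R] {P : Ideal R}
    (hP : P ≠ ⊤) {c : ℕ → R} (h0 : c 0 = 1) {n : ℕ} (hmem : ∀ i ≤ n, c (i + 1) ∈ P)
    (hlast : c (n + 1) ∉ P ^ 2) : (hornerPoly c (n + 1)).IsEisensteinAt P := by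
  have hmonic := isMonicOfDegree_hornerPoly h0 (n + 1)
  refine ⟨?_, fun {i} hi => ?_, ?_⟩
  · rwa [hmonic.leadingCoeff_eq, ← Ideal.ne_top_iff_one]
  · rw [hmonic.natDegree_eq] at hi
    rw [coeff_hornerPoly, if_pos hi.le, Nat.sub_add_comm (Nat.lt_succ_iff.1 hi)]
    exact hmem _ (n.sub_le i)
  · rwa [coeff_hornerPoly, if_pos (Nat.zero_le _), Nat.sub_zero]

/-- Synthetic division: the partial values of Horner's scheme at `x` are the coefficients of the
quotient by `X - x`. -/
theorem horner_sub_horner {R : Type*} [CommRing R] (c : ℕ → R) (x y : R) (n : ℕ) :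
    horner c x (n + 1) - horner c y (n + 1) = (x - y) * horner (horner c x) y n := by
  induction n with
  | zero => simp only [horner]; ring
  | succ n ih =>
    calc horner c x (n + 2) - horner c y (n + 2)
        = (x - y) * horner c x (n + 1) + y * (horner c x (n + 1) - horner c y (n + 1)) := by
          simp only [horner]; ring
      _ = (x - y) * horner (horner c x) y (n + 1) := by
          rw [ih, horner.eq_2 (horner c x)]; ring

theorem horner_inv_eq_mul_sum {K : Type*} [Field K] (c : ℕ → K) {w : K} (hw : w ≠ 0) (n : ℕ) :
    horner c w⁻¹ n = w⁻¹ ^ n * ∑ i ∈ Finset.range (n + 1), c i * w ^ i := by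
  induction n with
  | zero => simp [horner]
  | succ n ih =>
    rw [horner, ih, Finset.sum_range_succ _ (n + 1), mul_add, mul_left_comm _ (c _), ← mul_pow,
      inv_mul_cancel₀ hw, one_pow, mul_one, pow_succ', mul_assoc]

theorem horner_sub_mul_add {R : Type*} [CommRing R] {a c e : ℕ → R} {B : R} (h0 : c 0 = a 0)
    (h : ∀ n, c (n + 1) = a (n + 1) - B * a n + e n) (x : R) (n : ℕ) :
    horner c x (n + 1) = (x - B) * horner a x n + a (n + 1) + horner e x n := by
  induction n with
  | zero => simp only [horner, h, h0]; ring
  | succ n ih =>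
    rw [horner.eq_2 c, ih, horner.eq_2 a, horner.eq_2 e, h]
    ring

end Horner

section ChebyshevOrbit

theorem genChebyshev_cos_pi_mul {β u : ℝ} (hu : |u| ≤ 1) (k : ℤ) :
    genChebyshev β (Real.cos (Real.pi * u)) = Real.cos (Real.pi * (β * u + 2 * k)) := by
  have harccos : Real.arccos (Real.cos (Real.pi * u)) = |Real.pi * u| := by
    rw [← Real.cos_abs, Real.arccos_cos (abs_nonneg _)]
    rw [abs_mul, abs_of_pos Real.pi_pos]
    exact mul_le_of_le_one_right Real.pi_pos.le hu
  calc genChebyshev β (Real.cos (Real.pi * u))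
      = Real.cos (|β * (Real.pi * u)|) := by
        rw [genChebyshev, harccos, ← Real.cos_abs, abs_mul, abs_abs, ← abs_mul]
    _ = Real.cos (β * (Real.pi * u) + k * (2 * Real.pi)) := by
        rw [Real.cos_abs, Real.cos_add_int_mul_two_pi]
    _ = Real.cos (Real.pi * (β * u + 2 * k)) := by ring_nf

theorem iterate_genChebyshev_neg_one {β : ℝ} {c : ℕ → ℤ} {N : ℕ} (h0 : c 0 = 1)
    (hc : ∀ n, Even (c (n + 1))) (hu : ∀ n < N, |horner (fun i => (c i : ℝ)) β n| ≤ 1) :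
    (genChebyshev β)^[N] (-1) = Real.cos (Real.pi * horner (fun i => (c i : ℝ)) β N) := by
  induction N with
  | zero => simp [horner, h0]
  | succ N ih =>
    obtain ⟨k, hk⟩ := hc N
    rw [Function.iterate_succ_apply', ih fun n hn => hu n (hn.trans N.lt_succ_self),
      genChebyshev_cos_pi_mul (hu N N.lt_succ_self) k, horner, hk]
    push_cast
    ring_nf

theorem exists_even_forall_abs_horner_le_one (β : ℝ) :
    ∃ c : ℕ → ℤ, c 0 = 1 ∧ (∀ n, Even (c (n + 1))) ∧
      ∀ n, |horner (fun i => (c i : ℝ)) β n| ≤ 1 := by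
  let F : ℝ → ℝ := fun v => β * v - 2 * round (β * v / 2)
  let c : ℕ → ℤ
    | 0 => 1
    | n + 1 => -(2 * round (β * F^[n] 1 / 2))
  have hF : ∀ v, |F v| ≤ 1 := fun v => by
    calc |F v| = |2 * (β * v / 2 - round (β * v / 2))| := by simp only [F]; ring_nf
      _ ≤ 1 := by rw [abs_mul, abs_two]; linarith [abs_sub_round (β * v / 2)]
  have hcF : ∀ n, horner (fun i => (c i : ℝ)) β n = F^[n] 1 := by
    intro n
    induction n with
    | zero => simp [horner, c]
    | succ n ih => rw [Function.iterate_succ_apply', horner, ih]; simp [c, F, sub_eq_add_neg]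
  refine ⟨c, rfl, fun n => (even_two_mul _).neg, fun n => ?_⟩
  rw [hcF]
  cases n with
  | zero => simp
  | succ n => rw [Function.iterate_succ_apply']; exact hF _

theorem finite_forwardOrbit_of_isFixedPt {X : Type*} {f : X → X} {x : X} {N : ℕ}
    (h : Function.IsFixedPt f (f^[N] x)) : (forwardOrbit f x).Finite := by
  refine ((Set.finite_Iic N).image fun n => f^[n] x).subset ?_
  rintro _ ⟨n, rfl⟩
  rcases le_total n N with hn | hn
  · exact ⟨n, hn, rfl⟩
  · obtain ⟨j, rfl⟩ := Nat.exists_eq_add_of_le' hn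
    exact ⟨N, Set.self_mem_Iic, by simp only [Function.iterate_add_apply, (h.iterate j).eq]⟩

theorem finite_forwardOrbit_genChebyshev {β : ℝ} {c : ℕ → ℤ} {N : ℕ} (h0 : c 0 = 1)
    (hc : ∀ n, Even (c (n + 1))) (hu : ∀ n < N, |horner (fun i => (c i : ℝ)) β n| ≤ 1)
    (hN : horner (fun i => (c i : ℝ)) β N = 0) :
    (forwardOrbit (genChebyshev β) (-1)).Finite := by
  refine finite_forwardOrbit_of_isFixedPt (N := N) ?_
  rw [iterate_genChebyshev_neg_one h0 hc hu, hN, mul_zero, Real.cos_zero]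
  simp [Function.IsFixedPt, genChebyshev]

theorem finite_range_of_factorsThrough {ι α γ : Type*} {f : ι → α} {g : ι → γ}
    (h : g.FactorsThrough f) (hf : (Set.range f).Finite) : (Set.range g).Finite := by
  rcases isEmpty_or_nonempty ι with _ | ⟨⟨i⟩⟩
  · exact Set.finite_range g
  · rw [← h.extend_comp fun _ => g i, Set.range_comp]
    exact hf.image _

theorem finite_range_of_finite_range_cos {ι : Type*} {u : ι → ℝ} (hu : ∀ i, |u i| ≤ 1)
    (h : (Set.range fun i => Real.cos (Real.pi * u i)).Finite) : (Set.range u).Finite := by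
  have hmem : ∀ i, Real.pi * |u i| ∈ Set.Icc 0 Real.pi := fun i =>
    ⟨by positivity, mul_le_of_le_one_right Real.pi_pos.le (hu i)⟩
  have hfactor : (fun i => |u i|).FactorsThrough fun i => Real.cos (Real.pi * u i) := by
    intro i j hij
    have hcos : Real.cos (Real.pi * |u i|) = Real.cos (Real.pi * |u j|) := by
      rw [← abs_of_pos Real.pi_pos, ← abs_mul, ← abs_mul, Real.cos_abs, Real.cos_abs]
      exact hij
    exact mul_left_cancel₀ Real.pi_ne_zero (Real.injOn_cos (hmem i) (hmem j) hcos)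
  have habs := finite_range_of_factorsThrough hfactor h
  refine (habs.union habs.neg).subset ?_
  rintro _ ⟨i, rfl⟩
  rcases abs_choice (u i) with hi | hi
  · exact Or.inl ⟨i, hi⟩
  · exact Or.inr ⟨i, hi⟩

end ChebyshevOrbit

section GaloisConjugates

theorem aeval_eq_of_mem_galoisConjugates {β : ℝ} {z : ℂ} (hz : z ∈ galoisConjugates β)
    {p q : ℤ[X]} (h : aeval β p = aeval β q) : aeval z p = aeval z q := by
  have hβ : aeval β ((p - q).map (algebraMap ℤ ℚ)) = 0 := by
    rw [aeval_map_algebraMap, map_sub, h, sub_self]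
  have hpq := aeval_eq_zero_of_dvd_aeval_eq_zero (minpoly.dvd ℚ β hβ) (mem_rootSet.1 hz.1).2
  rwa [aeval_map_algebraMap, map_sub, sub_eq_zero] at hpq

theorem mem_galoisConjugates_of_irreducible {p : ℤ[X]} (hmonic : p.Monic) (hirr : Irreducible p)
    {β : ℝ} (hβ : aeval β p = 0) {z : ℂ} (hz : aeval z p = 0) (hne : z ≠ β) :
    z ∈ galoisConjugates β := by
  have hmin : p.map (algebraMap ℤ ℚ) = minpoly ℚ β :=
    minpoly.eq_of_irreducible_of_monic
      (hmonic.irreducible_iff_irreducible_map_fraction_map.1 hirr)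
      (by rwa [aeval_map_algebraMap]) (hmonic.map _)
  refine ⟨?_, hne⟩
  rw [← hmin]
  exact mem_rootSet.2 ⟨(hmonic.map _).ne_zero, by rwa [aeval_map_algebraMap]⟩

theorem irreducible_hornerPoly {c : ℕ → ℤ} (h0 : c 0 = 1) (hc : ∀ n, c (n + 1) ≡ 2 [ZMOD 4])
    (n : ℕ) : Irreducible (hornerPoly c (n + 1)) := by
  have hmonic := isMonicOfDegree_hornerPoly h0 (n + 1)
  have hprime : (Ideal.span {(2 : ℤ)}).IsPrime :=
    (Ideal.span_singleton_prime two_ne_zero).2 Int.prime_two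
  have heisenstein := isEisensteinAt_hornerPoly (n := n) hprime.ne_top h0
    (fun i _ => by
      have := hc i
      rw [Ideal.mem_span_singleton]
      grind [Int.ModEq])
    (by
      have := hc n
      rw [Ideal.span_singleton_pow, Ideal.mem_span_singleton]
      grind [Int.ModEq])
  exact heisenstein.irreducible hprime hmonic.monic.isPrimitive
    (by rw [hmonic.natDegree_eq]; exact n.succ_pos)

end GaloisConjugates

section ConjugatesOutsideDisk

theorem exists_norm_horner_le_of_mem_galoisConjugates {β : ℝ} {c : ℕ → ℤ} (h0 : c 0 = 1)
    (hc : ∀ n, Even (c (n + 1))) (hu : ∀ n, |horner (fun i => (c i : ℝ)) β n| ≤ 1)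
    (hfin : (forwardOrbit (genChebyshev β) (-1)).Finite) {z : ℂ} (hz : z ∈ galoisConjugates β) :
    ∃ M, ∀ n, ‖horner (fun i => (c i : ℂ)) z n‖ ≤ M := by
  have hcos : (Set.range fun n => Real.cos (Real.pi * horner (fun i => (c i : ℝ)) β n)).Finite := by
    simpa only [forwardOrbit, iterate_genChebyshev_neg_one h0 hc fun n _ => hu n] using hfin
  have hfactor : (horner (fun i => (c i : ℂ)) z).FactorsThrough
      (horner (fun i => (c i : ℝ)) β) := fun m n hmn => by
    have := aeval_eq_of_mem_galoisConjugates hz (p := hornerPoly c m) (q := hornerPoly c n)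
    simp only [aeval_hornerPoly, eq_intCast] at this
    exact this hmn
  have hrange := finite_range_of_factorsThrough hfactor (finite_range_of_finite_range_cos hu hcos)
  obtain ⟨M, hM⟩ := hrange.isBounded.exists_norm_le
  exact ⟨M, fun n => hM _ ⟨n, rfl⟩⟩

theorem tendsto_sum_horner_mul_pow {c : ℕ → ℂ} {x w : ℂ} {M : ℝ} (hw0 : w ≠ 0) (hw : ‖w‖ < 1)
    (hx : x ≠ w⁻¹) (hM : ∀ n, ‖horner c x n - horner c w⁻¹ n‖ ≤ M) :
    Tendsto (fun N => ∑ n ∈ Finset.range N, horner c x n * w ^ n) atTop (𝓝 0) := by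
  have hx' : x - w⁻¹ ≠ 0 := sub_ne_zero.2 hx
  rw [← tendsto_add_atTop_iff_nat 1]
  have hsum : ∀ N, ∑ n ∈ Finset.range (N + 1), horner c x n * w ^ n =
      (x - w⁻¹)⁻¹ * (w ^ N * (horner c x (N + 1) - horner c w⁻¹ (N + 1))) := fun N => by
    rw [horner_sub_horner, horner_inv_eq_mul_sum _ hw0, mul_left_comm, inv_mul_cancel_left₀ hx',
      ← mul_assoc, ← mul_pow, mul_inv_cancel₀ hw0, one_pow, one_mul]
  have hzero : Tendsto (fun N => w ^ N * (horner c x (N + 1) - horner c w⁻¹ (N + 1))) atTop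
      (𝓝 0) :=
    (tendsto_pow_atTop_nhds_zero_of_norm_lt_one hw).zero_mul_isBoundedUnder_le
      (isBoundedUnder_of ⟨M, fun N => hM (N + 1)⟩)
  simpa only [hsum, mul_zero] using hzero.const_mul (x - w⁻¹)⁻¹

theorem inv_mem_zeroSet_of_mem_galoisConjugates {β : ℝ}
    (hfin : (forwardOrbit (genChebyshev β) (-1)).Finite) {z : ℂ} (hz : z ∈ galoisConjugates β)
    (hz1 : 1 < ‖z‖) : z⁻¹ ∈ zeroSet (Set.Icc (-1) 1) := by
  obtain ⟨c, h0, hc, hu⟩ := exists_even_forall_abs_horner_le_one β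
  obtain ⟨M, hM⟩ := exists_norm_horner_le_of_mem_galoisConjugates h0 hc hu hfin hz
  have hz0 : z ≠ 0 := norm_pos_iff.1 (one_pos.trans hz1)
  have hw : ‖z⁻¹‖ < 1 := by rw [norm_inv]; exact inv_lt_one_of_one_lt₀ hz1
  have hu' : ∀ n, ‖horner (fun i => (c i : ℂ)) β n‖ ≤ 1 := fun n => by
    simpa only [← ofReal_horner, Complex.norm_real, Real.norm_eq_abs] using hu n
  have htendsto := tendsto_sum_horner_mul_pow (x := β) (inv_ne_zero hz0) hw
    (by rw [inv_inv]; exact Ne.symm hz.2)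
    fun n => (norm_sub_le _ _).trans (add_le_add (hu' n) (by rw [inv_inv]; exact hM n))
  have hsummable : Summable fun n => horner (fun i => (c i : ℂ)) β n * z⁻¹ ^ n :=
    Summable.of_norm_bounded (summable_geometric_of_lt_one (norm_nonneg _) hw) fun n => by
      rw [norm_mul, norm_pow]
      exact mul_le_of_le_one_left (by positivity) (hu' n)
  refine ⟨mem_ball_zero_iff.2 hw, horner (fun i => (c i : ℝ)) β,
    ⟨by simp [horner, h0], fun n _ => abs_le.1 (hu n)⟩, ?_⟩
  simpa only [ofReal_horner] using hsummable.hasSum_iff_tendsto_nat.2 htendsto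

end ConjugatesOutsideDisk

section Hurwitz

theorem exists_eq_zero_of_norm_lt_on_sphere {f : ℂ → ℂ} {w : ℂ} {t : ℝ} (ht : 0 < t)
    (hd : DiffContOnCl ℂ f (ball w t)) (h : ∀ x ∈ sphere w t, ‖f w‖ < ‖f x‖) :
    ∃ x ∈ closedBall w t, f x = 0 := by
  by_contra! hne
  obtain ⟨x₀, hx₀, hmin⟩ := (isCompact_sphere w t).exists_isMinOn
    (NormedSpace.sphere_nonempty.2 ht.le) (hd.continuousOn_ball.mono sphere_subset_closedBall).norm
  have hpos : 0 < ‖f x₀‖ := (norm_nonneg _).trans_lt (h x₀ hx₀)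
  have hinv : ‖(f w)⁻¹‖ ≤ ‖f x₀‖⁻¹ := by
    refine Complex.norm_le_of_forall_mem_frontier_norm_le isBounded_ball
      (hd.inv fun x hx => hne x (by rwa [closure_ball _ ht.ne'] at hx)) (fun x hx => ?_)
      (subset_closure (mem_ball_self ht))
    rw [frontier_ball _ ht.ne'] at hx
    rw [Pi.inv_apply, norm_inv]
    exact inv_anti₀ hpos (hmin hx)
  have hfw : 0 < ‖f w‖ := norm_pos_iff.2 (hne w (mem_closedBall_self ht.le))
  rw [norm_inv] at hinv
  exact ((inv_le_inv₀ hfw hpos).1 hinv).not_gt (h x₀ hx₀)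

theorem eventually_exists_eq_zero_of_tendstoUniformlyOn {ι : Type*} {l : Filter ι} {F : ι → ℂ → ℂ}
    {f : ℂ → ℂ} {U s : Set ℂ} {w : ℂ} (hF : TendstoUniformlyOn F f l U) (hU : U ∈ 𝓝 w)
    (hd : ∀ᶠ i in l, DifferentiableOn ℂ (F i) U) (hf : AnalyticAt ℂ f w) (hfw : f w = 0)
    (hne : ¬∀ᶠ x in 𝓝 w, f x = 0) (hs : s ∈ 𝓝 w) : ∀ᶠ i in l, ∃ x ∈ s, F i x = 0 := by
  have hpunctured := hf.eventually_eq_zero_or_eventually_ne_zero.resolve_left hne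
  rw [eventually_nhdsWithin_iff] at hpunctured
  obtain ⟨t, ht, hball⟩ := nhds_basis_closedBall.mem_iff.1
    (inter_mem (inter_mem hU hs) (hpunctured.and hf.eventually_continuousAt))
  have hcont : ContinuousOn f (sphere w t) := fun x hx =>
    (hball (sphere_subset_closedBall hx)).2.2.continuousWithinAt
  obtain ⟨x₀, hx₀, hmin⟩ := (isCompact_sphere w t).exists_isMinOn
    (NormedSpace.sphere_nonempty.2 ht.le) hcont.norm
  have hpos : 0 < ‖f x₀‖ := norm_pos_iff.2
    ((hball (sphere_subset_closedBall hx₀)).2.1 (ne_of_mem_sphere hx₀ ht.ne'))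
  filter_upwards [hd, Metric.tendstoUniformlyOn_iff.1 hF (‖f x₀‖ / 2) (half_pos hpos)]
    with i hdi hi
  have hdiff : DiffContOnCl ℂ (F i) (ball w t) := DifferentiableOn.diffContOnCl <|
    hdi.mono (by rw [closure_ball _ ht.ne']; exact fun x hx => (hball hx).1.1)
  obtain ⟨x, hx, hFx⟩ := exists_eq_zero_of_norm_lt_on_sphere ht hdiff fun x hx => by
    have hw := hi w (mem_of_mem_nhds hU)
    have hx' := hi x (hball (sphere_subset_closedBall hx)).1.1
    have hfx : ‖f x₀‖ ≤ ‖f x‖ := hmin hx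
    rw [hfw, dist_zero_left] at hw
    rw [dist_eq_norm] at hx'
    linarith [norm_sub_norm_le (f x) (F i x)]
  exact ⟨x, (hball hx).1.2, hFx⟩

end Hurwitz

/-- The sum of the power series with real coefficients `a`, as a function on `ℂ`. -/
noncomputable def coeffSeries (a : ℕ → ℝ) (z : ℂ) : ℂ := ∑' n, (a n : ℂ) * z ^ n

section CoeffSeries

variable {I : Set ℝ}

theorem exists_summable_norm_mul_pow_le (hI : Bornology.IsBounded I) {z : ℂ} (hz : ‖z‖ < 1) :
    ∃ U : Set ℂ, IsOpen U ∧ z ∈ U ∧ ∃ u : ℕ → ℝ, Summable u ∧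
      ∀ a ∈ coeffFamily I, ∀ w ∈ U, ∀ n, ‖(a n : ℂ) * w ^ n‖ ≤ u n := by
  obtain ⟨r, hzr, hr⟩ := exists_between hz
  obtain ⟨C, hC⟩ := (hI.insert 1).exists_norm_le
  refine ⟨ball 0 r, isOpen_ball, mem_ball_zero_iff.2 hzr, fun n => C * r ^ n,
    (summable_geometric_of_lt_one ((norm_nonneg z).trans hzr.le) hr).mul_left C,
    fun a ha w hw n => ?_⟩
  have han : ‖a n‖ ≤ C := hC _ <| n.eq_zero_or_pos.imp (by rintro rfl; exact ha.1) (ha.2 n)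
  rw [norm_mul, norm_pow, Complex.norm_real]
  exact mul_le_mul han (pow_le_pow_left₀ (norm_nonneg w) (mem_ball_zero_iff.1 hw).le n)
    (by positivity) ((norm_nonneg _).trans han)

theorem mem_zeroSet_iff (hI : Bornology.IsBounded I) {z : ℂ} :
    z ∈ zeroSet I ↔ ‖z‖ < 1 ∧ ∃ a ∈ coeffFamily I, coeffSeries a z = 0 := by
  rw [zeroSet, Set.mem_ofPred_eq, mem_ball_zero_iff]
  refine and_congr_right fun hz => exists_congr fun a => and_congr_right fun ha => ?_
  obtain ⟨U, -, hzU, u, hu, hle⟩ := exists_summable_norm_mul_pow_le hI hz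
  exact (Summable.of_norm_bounded hu (hle a ha z hzU)).hasSum_iff

theorem continuousOn_coeffSeries (hI : Bornology.IsBounded I) :
    ContinuousOn (Function.uncurry coeffSeries) (coeffFamily I ×ˢ ball 0 1) := by
  rintro ⟨a, z⟩ ⟨ha, hz⟩
  obtain ⟨U, hU, hzU, u, hu, hle⟩ := exists_summable_norm_mul_pow_le hI (mem_ball_zero_iff.1 hz)
  have hcont : ContinuousOn (Function.uncurry coeffSeries) (coeffFamily I ×ˢ U) :=
    continuousOn_tsum (fun n => by fun_prop) hu fun n p hp => hle p.1 hp.1 p.2 hp.2 n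
  refine (hcont (a, z) ⟨ha, hzU⟩).mono_of_mem_nhdsWithin ?_
  rw [nhdsWithin_prod_eq]
  exact prod_mem_prod self_mem_nhdsWithin (mem_nhdsWithin_of_mem_nhds (hU.mem_nhds hzU))

theorem differentiableOn_coeffSeries (hI : Bornology.IsBounded I) {a : ℕ → ℝ}
    (ha : a ∈ coeffFamily I) : DifferentiableOn ℂ (coeffSeries a) (ball 0 1) := fun z hz => by
  obtain ⟨U, hU, hzU, u, hu, hle⟩ := exists_summable_norm_mul_pow_le hI (mem_ball_zero_iff.1 hz)
  have hd : DifferentiableOn ℂ (coeffSeries a) U :=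
    Complex.differentiableOn_tsum_of_summable_norm hu (fun n => by fun_prop) hU
      fun n w hw => hle a ha w hw n
  exact (hd.differentiableAt (hU.mem_nhds hzU)).differentiableWithinAt

theorem coeffSeries_zero (a : ℕ → ℝ) : coeffSeries a 0 = a 0 := by
  rw [coeffSeries, tsum_eq_single 0 fun n hn => by simp [hn], pow_zero, mul_one]

theorem not_eventually_coeffSeries_eq_zero (hI : Bornology.IsBounded I) {a : ℕ → ℝ}
    (ha : a ∈ coeffFamily I) {w : ℂ} (hw : ‖w‖ < 1) : ¬∀ᶠ x in 𝓝 w, coeffSeries a x = 0 := by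
  intro h
  have han := (differentiableOn_coeffSeries hI ha).analyticOnNhd isOpen_ball
  have h0 := han.eqOn_zero_of_preconnected_of_eventuallyEq_zero (convex_ball 0 1).isPreconnected
    (mem_ball_zero_iff.2 hw) h (mem_ball_self one_pos)
  simp [coeffSeries_zero, ha.1] at h0

theorem tendstoUniformlyOn_coeffSeries (hI : Bornology.IsBounded I) {a : ℕ → ℝ}
    (ha : a ∈ coeffFamily I) {K : Set ℂ} (hK : IsCompact K) (hK1 : K ⊆ ball 0 1) :
    TendstoUniformlyOn coeffSeries (coeffSeries a) (𝓝[coeffFamily I] a) K := fun V hV => by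
  obtain ⟨W, hW, hWV⟩ := hK.mem_uniformity_of_prod
    ((continuousOn_coeffSeries hI).mono (Set.prod_mono_right hK1)) ha (symm_le_uniformity hV)
  filter_upwards [hW] with b hb x hx using hWV b hb x hx

theorem eventually_exists_coeffSeries_eq_zero (hI : Bornology.IsBounded I) {a : ℕ → ℝ}
    (ha : a ∈ coeffFamily I) {w : ℂ} (hw : ‖w‖ < 1) (haw : coeffSeries a w = 0) {s : Set ℂ}
    (hs : s ∈ 𝓝 w) : ∀ᶠ b in 𝓝[coeffFamily I] a, ∃ x ∈ s, coeffSeries b x = 0 := by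
  have hball : ball (0 : ℂ) 1 ∈ 𝓝 w := isOpen_ball.mem_nhds (mem_ball_zero_iff.2 hw)
  obtain ⟨K, hKw, hK1, hK⟩ := local_compact_nhds hball
  have hd : ∀ᶠ b in 𝓝[coeffFamily I] a, DifferentiableOn ℂ (coeffSeries b) K :=
    eventually_nhdsWithin_of_forall fun b hb => (differentiableOn_coeffSeries hI hb).mono hK1
  exact eventually_exists_eq_zero_of_tendstoUniformlyOn
    (tendstoUniformlyOn_coeffSeries hI ha hK hK1) hKw hd
    ((differentiableOn_coeffSeries hI ha).analyticAt hball) haw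
    (not_eventually_coeffSeries_eq_zero hI ha hw) hs

theorem isCompact_coeffFamily (hI : IsCompact I) : IsCompact (coeffFamily I) := by
  have h : coeffFamily I = Set.univ.pi fun n => if n = 0 then {1} else I := by
    ext a
    simp only [coeffFamily, Set.mem_ofPred_eq, Set.mem_univ_pi, Nat.one_le_iff_ne_zero]
    refine ⟨fun ha n => ?_, fun ha => ⟨by simpa using ha 0, fun n hn => by simpa [hn] using ha n⟩⟩
    split_ifs with hn
    · exact hn ▸ ha.1
    · exact ha.2 n hn
  rw [h]
  refine isCompact_univ_pi fun n => ?_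
  split_ifs
  · exact isCompact_singleton
  · exact hI

theorem isCompact_zeroSet_inter_closedBall (hI : IsCompact I) {r : ℝ} (hr : r < 1) :
    IsCompact (zeroSet I ∩ closedBall 0 r) := by
  have hK : IsCompact (coeffFamily I ×ˢ closedBall (0 : ℂ) r) :=
    (isCompact_coeffFamily hI).prod (isCompact_closedBall 0 r)
  have hzeros := hK.of_isClosed_subset
    (((continuousOn_coeffSeries hI.isBounded).mono
      (Set.prod_mono_right (closedBall_subset_ball hr))).preimage_isClosed_of_isClosed
        hK.isClosed (isClosed_singleton (x := 0))) Set.inter_subset_left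
  convert hzeros.image continuous_snd using 1
  ext w
  rw [Set.mem_inter_iff, mem_zeroSet_iff hI.isBounded]
  constructor
  · rintro ⟨⟨-, a, ha, haw⟩, hw⟩
    exact ⟨(a, w), ⟨⟨ha, hw⟩, haw⟩, rfl⟩
  · rintro ⟨⟨a, w⟩, ⟨⟨ha, hw⟩, haw⟩, rfl⟩
    exact ⟨⟨(mem_closedBall_zero_iff.1 hw).trans_lt hr, a, ha, haw⟩, hw⟩

theorem isClosed_closedBall_union_inv_zeroSet (hI : IsCompact I) :
    IsClosed (closedBall (0 : ℂ) 1 ∪ (zeroSet I)⁻¹) := by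
  rw [← isOpen_compl_iff, isOpen_iff_mem_nhds]
  intro z hz
  rw [Set.compl_union, Set.mem_inter_iff, Set.mem_compl_iff, mem_closedBall_zero_iff, not_le] at hz
  have hinv : ContinuousAt (·⁻¹) z := continuousAt_inv₀ (norm_pos_iff.1 (one_pos.trans hz.1))
  obtain ⟨r, hzr, hr⟩ := exists_between (inv_lt_one_of_one_lt₀ hz.1)
  rw [← norm_inv] at hzr
  have hout : ∀ᶠ y in 𝓝 z, y⁻¹ ∉ zeroSet I ∩ closedBall 0 r :=
    hinv.eventually_mem <|
      (isCompact_zeroSet_inter_closedBall hI hr).isClosed.isOpen_compl.mem_nhds fun h => hz.2 h.1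
  filter_upwards [hout, hinv.norm.eventually_lt_const hzr,
    continuous_norm.continuousAt.eventually_const_lt hz.1] with y hy hyr hy1
  rintro (h | h)
  · exact hy1.not_ge (mem_closedBall_zero_iff.1 h)
  · exact hy ⟨h, mem_closedBall_zero_iff.2 hyr.le⟩

end CoeffSeries

section RealRoot

theorem norm_horner_le {R : Type*} [NormedRing R] {e : ℕ → R} {M : ℝ} (he : ∀ n, ‖e n‖ ≤ M)
    (x : R) (n : ℕ) : ‖horner e x n‖ ≤ M * ∑ i ∈ Finset.range (n + 1), ‖x‖ ^ i := by
  induction n with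
  | zero => simpa [horner] using he 0
  | succ n ih =>
    calc ‖x * horner e x n + e (n + 1)‖
        ≤ ‖x‖ * (M * ∑ i ∈ Finset.range (n + 1), ‖x‖ ^ i) + M :=
          (norm_add_le _ _).trans <| add_le_add ((norm_mul_le _ _).trans (by gcongr)) (he _)
      _ = M * ∑ i ∈ Finset.range (n + 2), ‖x‖ ^ i := by
          rw [Finset.sum_range_succ' _ (n + 1), pow_zero, mul_add, mul_one, mul_left_comm,
            Finset.mul_sum]
          simp only [pow_succ']

variable {a c e : ℕ → ℝ} {B : ℝ}

theorem pow_sub_geom_sum_le_horner (h0 : a 0 = 1) (ha : ∀ n, |a n| ≤ 1) {x : ℝ} (hx : 0 ≤ x)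
    (n : ℕ) : x ^ n - ∑ i ∈ Finset.range n, x ^ i ≤ horner a x n := by
  induction n with
  | zero => simp [horner, h0]
  | succ n ih =>
    calc x ^ (n + 1) - ∑ i ∈ Finset.range (n + 1), x ^ i
        = x * (x ^ n - ∑ i ∈ Finset.range n, x ^ i) + -1 := by
          rw [Finset.sum_range_succ', mul_sub, Finset.mul_sum]
          simp only [pow_succ']
          ring
      _ ≤ x * horner a x n + a (n + 1) := by
          gcongr
          exact (abs_le.1 (ha (n + 1))).1

theorem abs_horner_le_six_mul_horner (h0 : a 0 = 1) (ha : ∀ n, |a n| ≤ 1) (he : ∀ n, |e n| ≤ 2)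
    {x : ℝ} (hx : 3 ≤ x) (n : ℕ) : |horner e x n| ≤ 6 * horner a x n := by
  have hx0 : 0 ≤ x := by linarith
  have hupper := norm_horner_le he x n
  have hlower := pow_sub_geom_sum_le_horner h0 ha hx0 n
  have hgeom : 2 * ∑ i ∈ Finset.range n, x ^ i ≤ x ^ n :=
    calc 2 * ∑ i ∈ Finset.range n, x ^ i ≤ (x - 1) * ∑ i ∈ Finset.range n, x ^ i := by
          gcongr; linarith
      _ ≤ x ^ n := by rw [mul_geom_sum]; linarith
  rw [Real.norm_eq_abs, Real.norm_of_nonneg hx0, Finset.sum_range_succ] at hupper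
  linarith

theorem continuous_horner {R : Type*} [Semiring R] [TopologicalSpace R] [IsTopologicalSemiring R]
    (c : ℕ → R) (n : ℕ) : Continuous fun x => horner c x n := by
  induction n with
  | zero => exact continuous_const
  | succ n ih => exact (continuous_id.mul ih).add continuous_const

theorem exists_horner_eq_zero_of_sub_mul_add (hc0 : c 0 = a 0) (ha0 : a 0 = 1)
    (ha : ∀ n, |a n| ≤ 1) (he : ∀ n, |e n| ≤ 2) (h : ∀ n, c (n + 1) = a (n + 1) - B * a n + e n)
    {m : ℕ} (ham : a (m + 1) = 0) (hB : 9 ≤ B) :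
    ∃ β ∈ Set.Icc (B - 6) (B + 6), horner c β (m + 1) = 0 := by
  apply intermediate_value_Icc (by linarith) (continuous_horner c (m + 1)).continuousOn
  simp only [horner_sub_mul_add hc0 h, ham, add_zero]
  have hleft := abs_le.1 (abs_horner_le_six_mul_horner ha0 ha he (by linarith : 3 ≤ B - 6) m)
  have hright := abs_le.1 (abs_horner_le_six_mul_horner ha0 ha he (by linarith : 3 ≤ B + 6) m)
  constructor <;> linarith

/-- Since `β` expands errors under forward iteration, the error is controlled by going backwards
from the common value `0` at time `m + 1`. -/
theorem abs_horner_sub_le (ha : ∀ n, |a n| ≤ 1) (he : ∀ n, |e n| ≤ 2)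
    (h : ∀ n, c (n + 1) = a (n + 1) - B * a n + e n) {m : ℕ} (ham : a (m + 1) = 0) {β : ℝ}
    (hβ1 : 1 < β) (hβB : |β - B| ≤ 6) (hroot : horner c β (m + 1) = 0) {n : ℕ}
    (hn : n ≤ m + 1) : |horner c β n - a n| ≤ 8 / (β - 1) := by
  have hβ0 : 0 < β := one_pos.trans hβ1
  have hβ1' : 0 < β - 1 := sub_pos.2 hβ1
  induction hn using Nat.decreasingInduction with
  | self => rw [hroot, ham, sub_zero, abs_zero]; positivity
  | of_succ n _ ih =>
    refine le_of_mul_le_mul_left ?_ hβ0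
    calc β * |horner c β n - a n|
        = |(horner c β (n + 1) - a (n + 1)) - (β - B) * a n - e n| := by
          rw [← abs_of_pos hβ0, ← abs_mul, abs_of_pos hβ0, horner, h]
          ring_nf
      _ ≤ 8 / (β - 1) + 6 * 1 + 2 := by
          refine (abs_sub _ _).trans (add_le_add ((abs_sub _ _).trans (add_le_add ih ?_)) (he n))
          rw [abs_mul]
          exact mul_le_mul hβB (ha n) (abs_nonneg _) (by norm_num)
      _ = β * (8 / (β - 1)) := by
          field_simp
          ring

theorem exists_int_modEq_abs_sub_le (q : ℝ) (k : ℤ) {n : ℤ} (hn : 0 < n) :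
    ∃ j : ℤ, j ≡ k [ZMOD n] ∧ |(j : ℝ) - q| ≤ n / 2 := by
  have hn' : (0 : ℝ) < n := Int.cast_pos.2 hn
  refine ⟨k + n * round ((q - k) / n), Int.modEq_iff_add_fac.2 ⟨_, rfl⟩ |>.symm, ?_⟩
  calc |((k + n * round ((q - k) / n) : ℤ) : ℝ) - q|
      = n * |(q - k) / n - round ((q - k) / n)| := by
        rw [← abs_of_pos hn', ← abs_mul, abs_of_pos hn', abs_sub_comm, mul_sub,
          mul_div_cancel₀ _ hn'.ne']
        push_cast
        ring_nf
    _ ≤ n * (1 / 2) := by gcongr; exact abs_sub_round _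
    _ = n / 2 := mul_one_div _ _

theorem exists_modEq_two_abs_horner_sub_le (ha0 : a 0 = 1) (ha : ∀ n, |a n| ≤ 1) (m : ℕ)
    {η : ℝ} (hη : 0 < η) (R : ℝ) :
    ∃ (c : ℕ → ℤ) (β : ℝ), c 0 = 1 ∧ (∀ n, c (n + 1) ≡ 2 [ZMOD 4]) ∧ R < β ∧
      horner (fun i => (c i : ℝ)) β (m + 1) = 0 ∧
      ∀ n ≤ m, |horner (fun i => (c i : ℝ)) β n - a n| ≤ η := by
  let a' : ℕ → ℝ := Function.update a (m + 1) 0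
  have ha'0 : a' 0 = 1 := by simp [a', ha0]
  have ha'm : a' (m + 1) = 0 := Function.update_self ..
  have ha' : ∀ n, |a' n| ≤ 1 := fun n => by
    obtain rfl | hn := eq_or_ne n (m + 1)
    · simp [ha'm]
    · simpa [a', hn] using ha n
  obtain ⟨B, hB⟩ : ∃ B, B = max R 0 + 9 + 8 / η := ⟨_, rfl⟩
  have hR : R ≤ max R 0 := le_max_left R 0
  have hR0 : 0 ≤ max R 0 := le_max_right R 0
  have h8η : 0 < 8 / η := by positivity
  choose k hk hkq using fun n =>
    exists_int_modEq_abs_sub_le (a' (n + 1) - B * a' n) 2 (n := 4) (by norm_num)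
  let c : ℕ → ℤ
    | 0 => 1
    | n + 1 => k n
  let e : ℕ → ℝ := fun n => k n - (a' (n + 1) - B * a' n)
  have he : ∀ n, |e n| ≤ 2 := fun n => (hkq n).trans_eq (by norm_num)
  have hc : ∀ n, (c (n + 1) : ℝ) = a' (n + 1) - B * a' n + e n := fun n =>
    (add_sub_cancel _ _).symm
  obtain ⟨β, ⟨hβl, hβr⟩, hroot⟩ := exists_horner_eq_zero_of_sub_mul_add (c := fun i => (c i : ℝ))
    (by simp [c, ha'0]) ha'0 ha' he hc ha'm (by linarith)
  have hβ1 : 1 < β := by linarith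
  refine ⟨c, β, rfl, hk, by linarith, hroot, fun n hn => ?_⟩
  have hclose := abs_horner_sub_le (c := fun i => (c i : ℝ)) ha' he hc ha'm hβ1
    (abs_le.2 ⟨by linarith, by linarith⟩) hroot (Nat.le_succ_of_le hn)
  rw [show a' n = a n from Function.update_of_ne (by lia) ..] at hclose
  refine hclose.trans ?_
  rw [div_le_comm₀ (by linarith) hη]
  linarith

end RealRoot

/-- The Galois conjugates of the real numbers `β > 1` for which the generalized Chebyshev map is
post-critically finite; the theorem computes the closure of this set. -/
def pcfConjugates : Set ℂ :=
  {z | ∃ β : ℝ, 1 < β ∧ (forwardOrbit (genChebyshev β) (-1)).Finite ∧ z ∈ galoisConjugates β}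

/-- The zeros of the monic real polynomials whose other coefficients have absolute value less than
`1`; these polynomials form an intermediate family between the minimal polynomials of
post-critically finite `β` and the power series defining `zeroSet (Set.Icc (-1) 1)`. -/
def smallCoeffRoots : Set ℂ :=
  {z | ∃ a ∈ coeffFamily (Set.Ioo (-1) 1), ∃ m, horner (fun n => (a n : ℂ)) z m = 0}

section SmallCoeffRoots

theorem eventually_exists_horner_eq_zero {a : ℕ → ℂ} (ha0 : a 0 = 1) {z : ℂ} {m : ℕ}
    (hz : horner a z m = 0) {ε : ℝ} (hε : 0 < ε) :
    ∀ᶠ η : ℝ in 𝓝[>] 0, ∀ b : ℕ → ℂ, b 0 = 1 → (∀ n ≤ m, ‖b n - a n‖ < η) →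
      ∃ r, horner b r m = 0 ∧ ‖z - r‖ < ε := by
  have hm : m ≠ 0 := by
    rintro rfl
    exact one_ne_zero (ha0.symm.trans hz)
  have hradius : Tendsto (fun η : ℝ => ((m + 1) * η) ^ (m : ℝ)⁻¹ * max ‖z‖ 1) (𝓝[>] 0)
      (𝓝 0) := by
    have hcont : Continuous fun η : ℝ => ((m + 1) * η) ^ (m : ℝ)⁻¹ * max ‖z‖ 1 :=
      ((continuous_const.mul continuous_id).rpow_const fun _ => Or.inr (by positivity)).mul_const _
    refine (hcont.tendsto' 0 0 ?_).mono_left nhdsWithin_le_nhds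
    rw [mul_zero, Real.zero_rpow (by positivity), zero_mul]
  have heval : ∀ (c : ℕ → ℂ) (x : ℂ), (hornerPoly c m).eval x = horner c x m := fun c x => by
    rw [← coe_aeval_eq_eval, aeval_hornerPoly]; rfl
  filter_upwards [self_mem_nhdsWithin, hradius.eventually_lt_const hε] with η hη hηε b hb0 hb
  have hfa := isMonicOfDegree_hornerPoly ha0 m
  have hfb := isMonicOfDegree_hornerPoly hb0 m
  obtain ⟨r, hr, hzr⟩ := exists_roots_norm_sub_lt_of_norm_coeff_sub_lt hη ((heval a z).trans hz)
    hfa.monic hfb.monic (hfb.natDegree_eq.trans hfa.natDegree_eq.symm)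
    (fun i => by
      simp only [coeff_hornerPoly]
      split_ifs
      · exact hb _ (m.sub_le i)
      · simpa using hη)
    (IsAlgClosed.splits _)
  rw [hfa.natDegree_eq] at hzr
  exact ⟨r, (heval b r).symm.trans (isRoot_of_mem_roots hr), hzr.trans hηε⟩

theorem mem_pcfConjugates_of_horner_horner_eq_zero {c : ℕ → ℤ} (h0 : c 0 = 1)
    (hc : ∀ n, c (n + 1) ≡ 2 [ZMOD 4]) {β : ℝ} (hβ : 1 < β) {m : ℕ}
    (hu : ∀ n ≤ m, |horner (fun i => (c i : ℝ)) β n| ≤ 1)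
    (hroot : horner (fun i => (c i : ℝ)) β (m + 1) = 0) {r : ℂ} (hrβ : r ≠ β)
    (hr : horner (horner (fun i => (c i : ℂ)) β) r m = 0) : r ∈ pcfConjugates := by
  have hcβ : horner (fun i => (c i : ℂ)) β (m + 1) = 0 := by
    rw [← ofReal_horner, hroot, Complex.ofReal_zero]
  have hcr : horner (fun i => (c i : ℂ)) r (m + 1) = 0 := by
    have hsub := horner_sub_horner (fun i => (c i : ℂ)) β r m
    rwa [hr, mul_zero, hcβ, zero_sub, neg_eq_zero] at hsub
  have heven : ∀ n, Even (c (n + 1)) := fun n => by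
    have := hc n
    grind [Int.ModEq]
  exact ⟨β, hβ, finite_forwardOrbit_genChebyshev h0 heven
      (fun n hn => hu n (Nat.le_of_lt_succ hn)) hroot,
    mem_galoisConjugates_of_irreducible (isMonicOfDegree_hornerPoly h0 (m + 1)).monic
      (irreducible_hornerPoly h0 hc m) (by simpa only [aeval_hornerPoly, eq_intCast] using hroot)
      (by simpa only [aeval_hornerPoly, eq_intCast] using hcr) hrβ⟩

theorem smallCoeffRoots_subset_closure_pcfConjugates :
    smallCoeffRoots ⊆ closure pcfConjugates := by
  rintro z ⟨a, ⟨ha0, ha⟩, m, hz⟩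
  refine Metric.mem_closure_iff.2 fun ε hε => ?_
  have ha1 : ∀ n, n ≠ 0 → |a n| < 1 := fun n hn => abs_lt.2 (ha n (Nat.one_le_iff_ne_zero.2 hn))
  have hroom : ∀ᶠ η : ℝ in 𝓝[>] 0, ∀ n ∈ Finset.Icc 1 m, η < 1 - |a n| :=
    (Filter.eventually_all_finset _).2 fun n hn => nhdsWithin_le_nhds <|
      gt_mem_nhds (sub_pos.2 (ha1 n (Nat.one_le_iff_ne_zero.1 (Finset.mem_Icc.1 hn).1)))
  obtain ⟨η, ⟨hηroots, hηroom⟩, hη⟩ := ((eventually_exists_horner_eq_zero (by simp [ha0]) hz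
    hε).and hroom |>.and self_mem_nhdsWithin).exists
  obtain ⟨c, β, hc0, hc, hβ, hroot, hclose⟩ := exists_modEq_two_abs_horner_sub_le ha0
    (fun n => n.eq_zero_or_pos.elim (by rintro rfl; simp [ha0]) fun hn => (ha1 n hn.ne').le)
    m (half_pos hη) (1 + ‖z‖ + ε)
  obtain ⟨r, hr, hzr⟩ := hηroots (horner (fun i => (c i : ℂ)) β) (by simp [horner, hc0])
    fun n hn => by
      rw [← ofReal_horner, ← Complex.ofReal_sub, Complex.norm_real, Real.norm_eq_abs]
      exact (hclose n hn).trans_lt (half_lt_self hη)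
  have hrβ : r ≠ β := by
    rintro rfl
    have := norm_sub_norm_le (β : ℂ) z
    rw [norm_sub_rev, Complex.norm_real, Real.norm_eq_abs] at this
    linarith [le_abs_self β]
  refine ⟨r, mem_pcfConjugates_of_horner_horner_eq_zero hc0 hc
    (by linarith [norm_nonneg z]) (fun n hn => ?_) hroot hrβ hr, by rwa [dist_eq_norm]⟩
  obtain rfl | hn0 := eq_or_ne n 0
  · simp [horner, hc0]
  · have := hηroom n (Finset.mem_Icc.2 ⟨Nat.one_le_iff_ne_zero.2 hn0, hn⟩)
    have := abs_sub_abs_le_abs_sub (horner (fun i => (c i : ℝ)) β n) (a n)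
    linarith [hclose n hn, half_lt_self hη]

theorem div_im_mul_add_eq {z w : ℂ} (h : z.im = 0 → w.im = 0) :
    ((w.im / z.im : ℝ) : ℂ) * z + (w.re - w.im / z.im * z.re : ℝ) = w := by
  refine Complex.ext (by simp) ?_
  simpa using div_mul_cancel_of_imp h

theorem exists_pow_add_mul_add_eq_zero {z : ℂ} (hz : ‖z‖ < 1) :
    ∃ (k : ℕ) (α γ : ℝ), |α| < 1 ∧ |γ| < 1 ∧ z ^ (k + 2) + α * z + γ = 0 := by
  let α : ℕ → ℝ := fun n => (z ^ n).im / z.im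
  let γ : ℕ → ℝ := fun n => (z ^ n).re - α n * z.re
  have hpow : Tendsto (z ^ ·) atTop (𝓝 0) := tendsto_pow_atTop_nhds_zero_of_norm_lt_one hz
  have hre : Tendsto (fun n => (z ^ n).re) atTop (𝓝 0) :=
    (Complex.continuous_re.tendsto 0).comp hpow
  have him : Tendsto (fun n => (z ^ n).im) atTop (𝓝 0) :=
    (Complex.continuous_im.tendsto 0).comp hpow
  have hα : Tendsto α atTop (𝓝 0) := by simpa using him.div_const z.im
  have hγ : Tendsto γ atTop (𝓝 0) := by simpa using hre.sub (hα.mul_const z.re)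
  have hsmall : ∀ {u : ℕ → ℝ}, Tendsto u atTop (𝓝 0) → ∀ᶠ n in atTop, |u n| < 1 := fun hu =>
    hu.abs.eventually_lt_const (by simp)
  obtain ⟨n, ⟨hαn, hγn⟩, hn⟩ :=
    ((hsmall hα).and (hsmall hγ) |>.and (eventually_ge_atTop 2)).exists
  obtain ⟨k, rfl⟩ := Nat.exists_eq_add_of_le' hn
  refine ⟨k, -α (k + 2), -γ (k + 2), by rwa [abs_neg], by rwa [abs_neg], ?_⟩
  have hreal : z.im = 0 → (z ^ (k + 2)).im = 0 := fun h => by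
    rw [← Complex.conj_eq_iff_im] at h ⊢
    rw [map_pow, h]
  have := div_im_mul_add_eq hreal
  push_cast
  linear_combination -this

theorem ball_subset_smallCoeffRoots : ball 0 1 ⊆ smallCoeffRoots := by
  intro z hz
  obtain ⟨k, α, γ, hα, hγ, hrel⟩ := exists_pow_add_mul_add_eq_zero (mem_ball_zero_iff.1 hz)
  let a : ℕ → ℝ := fun n => if n = 0 then 1 else if n = k + 1 then α else if n = k + 2 then γ else 0
  have ha : a ∈ coeffFamily (Set.Ioo (-1) 1) := by
    refine ⟨rfl, fun n hn => abs_lt.1 ?_⟩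
    simp only [a, if_neg (Nat.one_le_iff_ne_zero.1 hn)]
    split_ifs
    exacts [hα, hγ, by simp]
  have hpow : horner (fun n => (a n : ℂ)) z k = z ^ k :=
    horner_eq_pow (by simp [a]) (fun n hn => by
      simp only [a]
      rw [if_neg (by lia), if_neg (by lia), if_neg (by lia), Complex.ofReal_zero]) z
  refine ⟨a, ha, k + 2, ?_⟩
  rw [horner, horner, hpow, show a (k + 1) = α by simp [a], show a (k + 2) = γ by simp [a], ← hrel]
  ring

theorem mem_closure_coeffFamily_Ioo {a : ℕ → ℝ} (ha : a ∈ coeffFamily (Set.Icc (-1) 1)) :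
    a ∈ closure {b ∈ coeffFamily (Set.Ioo (-1) 1) | ∃ N, ∀ n > N, b n = 0} := by
  let b : ℕ → ℕ → ℝ := fun N n => if n = 0 then 1 else if n ≤ N then N / (N + 1) * a n else 0
  have hb : Tendsto b atTop (𝓝 a) := tendsto_pi_nhds.2 fun n => by
    obtain rfl | hn := eq_or_ne n 0
    · simp [b, ha.1]
    · have := (tendsto_natCast_div_add_atTop (1 : ℝ)).mul_const (a n)
      rw [one_mul] at this
      refine this.congr' ?_
      filter_upwards [eventually_ge_atTop n] with N hN
      simp [b, hn, hN]
  refine mem_closure_of_tendsto hb (Eventually.of_forall fun N => ⟨⟨rfl, fun n hn => ?_⟩, N, ?_⟩)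
  · have hdamp : (N : ℝ) / (N + 1) < 1 := (div_lt_one (by positivity)).2 (lt_add_one _)
    simp only [b, if_neg (Nat.one_le_iff_ne_zero.1 hn)]
    split_ifs
    · rw [Set.mem_Ioo, ← abs_lt, abs_mul, abs_of_nonneg (by positivity)]
      exact (mul_le_of_le_one_right (by positivity) (abs_le.2 (ha.2 n hn))).trans_lt hdamp
    · simp
  · intro n hn
    simp only [b, if_neg hn.not_ge, ite_eq_right_iff]
    lia

theorem inv_mem_smallCoeffRoots {b : ℕ → ℝ} (hb : b ∈ coeffFamily (Set.Ioo (-1) 1)) {N : ℕ}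
    (hN : ∀ n > N, b n = 0) {x : ℂ} (hx : coeffSeries b x = 0) : x⁻¹ ∈ smallCoeffRoots := by
  have hx0 : x ≠ 0 := by
    rintro rfl
    simp [coeffSeries_zero, hb.1] at hx
  rw [coeffSeries, tsum_eq_sum (s := Finset.range (N + 1)) fun n hn => by
    rw [hN n (by simpa using hn), Complex.ofReal_zero, zero_mul]] at hx
  exact ⟨b, hb, N, by rw [horner_inv_eq_mul_sum _ hx0, hx, mul_zero]⟩

theorem inv_zeroSet_subset_closure_smallCoeffRoots :
    (zeroSet (Set.Icc (-1) 1))⁻¹ ⊆ closure smallCoeffRoots := by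
  intro z hz
  obtain ⟨hw, a, ha, haw⟩ := (mem_zeroSet_iff (isBounded_Icc (-1) 1)).1 hz
  have hw0 : z⁻¹ ≠ 0 := fun h => by simp [h, coeffSeries_zero, ha.1] at haw
  refine mem_closure_iff_nhds.2 fun s hs => ?_
  have hs' : Inv.inv ⁻¹' s ∈ 𝓝 z⁻¹ := continuousAt_inv₀ hw0 (by rwa [inv_inv])
  have hzeros := eventually_nhdsWithin_iff.1
    (eventually_exists_coeffSeries_eq_zero (isBounded_Icc (-1) 1) ha hw haw hs')
  obtain ⟨b, ⟨hb, N, hN⟩, hbzero⟩ :=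
    ((mem_closure_iff_frequently.1 (mem_closure_coeffFamily_Ioo ha)).and_eventually hzeros).exists
  obtain ⟨x, hxs, hbx⟩ := hbzero ⟨hb.1, fun n hn => Set.Ioo_subset_Icc_self (hb.2 n hn)⟩
  exact ⟨x⁻¹, hxs, inv_mem_smallCoeffRoots hb hN hbx⟩

end SmallCoeffRoots

theorem corollary2p6 :
    closure {z : ℂ | ∃ β : ℝ, 1 < β ∧
        (forwardOrbit (genChebyshev β) (-1)).Finite ∧ z ∈ galoisConjugates β} =
      closure (Metric.ball (0 : ℂ) 1) ∪ (zeroSet (Set.Icc (-1) 1))⁻¹ := by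
  apply subset_antisymm
  · rw [closure_ball _ one_ne_zero]
    refine closure_minimal ?_ (isClosed_closedBall_union_inv_zeroSet isCompact_Icc)
    rintro z ⟨β, -, hfin, hz⟩
    rcases le_or_gt ‖z‖ 1 with hz1 | hz1
    · exact Or.inl (mem_closedBall_zero_iff.2 hz1)
    · exact Or.inr (inv_mem_zeroSet_of_mem_galoisConjugates hfin hz hz1)
  · have hroots : closure smallCoeffRoots ⊆ closure pcfConjugates :=
      closure_minimal smallCoeffRoots_subset_closure_pcfConjugates isClosed_closure
    exact Set.union_subset ((closure_mono ball_subset_smallCoeffRoots).trans hroots)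
      (inv_zeroSet_subset_closure_smallCoeffRoots.trans hroots)
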